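/- Let $H(\mathbb{C})$ be the space of entire functions with the topology of uniform convergence on compact sets. An entire function $\Phi(z)=\sum_{k\ge 0} a_k z^k$ is of exponential type if there are constants $A,B>0$ with $|\Phi(z)|\le A e^{B|z|}$ for all $z\in\mathbb{C}$; it then defines a continuous linear operator $\Phi(D)$ on $H(\mathbb{C})$ by $(\Phi(D)f)(z)=\sum_{k\ge 0} a_k f^{(k)}(z)$. A sequence $(T_n)_{n\ge 1}$ of continuous linear operators on $H(\mathbb{C})$ is frequently hypercyclic if there is $f\in H(\mathbb{C})$ such that, for every nonempty open set $U\subset H(\mathbb{C})$, $$\liminf_{N\to\infty}\frac{\operatorname{card}\{1\le n\le N:\ T_n f\in U\}}{N}>0 .$$ **Theorem.** Let $(\Phi_n)_{n\ge 1}$ be a sequence of entire functions of exponential type, and let $\Phi_0\equiv 1$. Assume that there exist positive reals $R_1,R_2,R_3$, $\alpha_{n,j}$ $(n>j\ge 0)$ and $\beta_{n,j}$ $(n>j\ge 1)$ such that: (a) $\sup_{n\ge 1}\sum_{j=0}^{n-1}\alpha_{n,j}<+\infty$ and $\sup_{j\ge 1}\sum_{n=j+1}^{\infty}\beta_{n,j}<+\infty$;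 (b) $\Phi_n(t)\ne 0$ for all $n\ge 1$ and all $t\in\mathbb{C}$ with $\min\{R_1,R_2,R_3\}\le|t|\le\max\{R_1,R_2,R_3\}$; (c) $|\Phi_n(t)|\le\alpha_{n,j}|\Phi_j(t)|$ whenever $|t|=R_1$ and $n>j\ge 0$; (d) $|\Phi_j(t)|\le\beta_{n,j}|\Phi_n(t)|$ whenever $|t|=R_2$ and $n>j\ge 1$; (e) the series $\sum_{n=1}^{\infty}\dfrac{1}{\min_{|t|=R_3}|\Phi_n(t)|}$ converges. Then the sequence of operators $(\Phi_n(D))_{n\ge 1}$ is frequently hypercyclic on $H(\mathbb{C})$. -/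

import Mathlib

open Filter Topology Metric

/-- The space `H(ℂ)` of entire functions, a linear subspace of `C(ℂ, ℂ)`. It carries the subspace
topology of the compact-open topology, i.e. the topology of uniform convergence on compacta. -/
def EntireFunction : Submodule ℂ C(ℂ, ℂ) where
  carrier := {f | Differentiable ℂ (f : ℂ → ℂ)}
  add_mem' := fun hf hg => Differentiable.add hf hg
  zero_mem' := differentiable_const (0 : ℂ)
  smul_mem' := fun c _ hf => Differentiable.const_smul hf c

/-- `Φ` is an entire function of exponential type. -/
def IsExponentialType (Φ : ℂ → ℂ) : Prop :=
  Differentiable ℂ Φ ∧ ∃ A B : ℝ, 0 < A ∧ 0 < B ∧ ∀ z : ℂ, ‖Φ z‖ ≤ A * Real.exp (B * ‖z‖)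

/-- The `k`-th Taylor coefficient of `Φ` at the origin. -/
noncomputable def taylorCoeffZero (Φ : ℂ → ℂ) (k : ℕ) : ℂ :=
  iteratedDeriv k Φ 0 / (k.factorial : ℂ)

theorem IsExponentialType.norm_term_le {Φ : ℂ → ℂ} (hΦ : IsExponentialType Φ) :
    ∃ C ρ : ℝ, 0 < C ∧ 0 < ρ ∧ ∀ f : ℂ → ℂ, Differentiable ℂ f → ∀ (z : ℂ) (M : ℝ),
      (∀ w ∈ closedBall z ρ, ‖f w‖ ≤ M) → ∀ k : ℕ,
        ‖taylorCoeffZero Φ k * iteratedDeriv k f z‖ ≤ C * M * (1 / 2) ^ k := by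
  obtain ⟨hd, A, B, hA, hB, hAB⟩ := hΦ
  have hcoef : ∀ k : ℕ, ‖iteratedDeriv k Φ 0‖ ≤ A * Real.exp B * Real.exp B ^ k := by
    intro k
    have hk : (0 : ℝ) < (k : ℝ) + 1 := by positivity
    have h1 := Complex.norm_iteratedDeriv_le_of_forall_mem_sphere_norm_le (c := 0) (f := Φ) k hk
      hd.diffContOnCl (C := A * Real.exp (B * ((k : ℝ) + 1))) (fun z hz => by
        have h := hAB z
        rwa [mem_sphere_zero_iff_norm.1 hz] at h)
    refine h1.trans ?_
    have h2 : (k.factorial : ℝ) ≤ ((k : ℝ) + 1) ^ k := by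
      have h3 : k.factorial ≤ (k + 1) ^ k :=
        (Nat.factorial_le_pow k).trans (Nat.pow_le_pow_left (Nat.le_succ k) k)
      exact_mod_cast h3
    have h4 : Real.exp (B * ((k : ℝ) + 1)) = Real.exp B * Real.exp B ^ k := by
      rw [← Real.exp_nat_mul, ← Real.exp_add]
      ring_nf
    rw [div_le_iff₀ (by positivity), h4, mul_comm, ← mul_assoc]
    gcongr
  refine ⟨A * Real.exp B, 2 * Real.exp B, by positivity, by positivity, ?_⟩
  intro f hf z M hM k
  have hM0 : 0 ≤ M := (norm_nonneg _).trans (hM z (mem_closedBall_self (by positivity)))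
  have h1 := Complex.norm_iteratedDeriv_le_of_forall_mem_sphere_norm_le (c := z) (f := f)
    (R := 2 * Real.exp B) (C := M) k (by positivity) hf.diffContOnCl
    (fun w hw => hM w (sphere_subset_closedBall hw))
  have hk : (0 : ℝ) < k.factorial := by positivity
  rw [norm_mul, taylorCoeffZero, norm_div, Complex.norm_natCast]
  calc ‖iteratedDeriv k Φ 0‖ / k.factorial * ‖iteratedDeriv k f z‖
      ≤ (A * Real.exp B * Real.exp B ^ k) / k.factorial *
          (k.factorial * M / (2 * Real.exp B) ^ k) := by
        gcongr
        exact hcoef k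
    _ = A * Real.exp B * M * (1 / 2) ^ k := by
        have := Real.exp_pos B
        rw [mul_pow, div_pow, one_pow]
        field_simp

theorem EntireFunction.exists_bound (f : EntireFunction) (r : ℝ) :
    ∃ M : ℝ, ∀ w ∈ closedBall (0 : ℂ) r, ‖(f : C(ℂ, ℂ)) w‖ ≤ M :=
  (isCompact_closedBall (0 : ℂ) r).exists_bound_of_continuousOn
    (f : C(ℂ, ℂ)).continuous.continuousOn

theorem closedBall_subset_closedBall_zero {z : ℂ} {r ρ : ℝ} (hz : ‖z‖ ≤ r) :
    closedBall z ρ ⊆ closedBall (0 : ℂ) (r + ρ) := by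
  intro w hw
  rw [mem_closedBall, dist_eq_norm] at hw
  rw [mem_closedBall_zero_iff]
  have h := norm_add_le (w - z) z
  rw [sub_add_cancel] at h
  linarith

/-- The series `∑ aₖ f⁽ᵏ⁾(z)` converges (absolutely) for `Φ = ∑ aₖ zᵏ` of exponential type. -/
theorem summable_diffOp {Φ : ℂ → ℂ} (hΦ : IsExponentialType Φ) (f : EntireFunction) (z : ℂ) :
    Summable fun k : ℕ => taylorCoeffZero Φ k * iteratedDeriv k (f : C(ℂ, ℂ)) z := by
  obtain ⟨C, ρ, hC, hρ, h⟩ := hΦ.norm_term_le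
  obtain ⟨M, hM⟩ := EntireFunction.exists_bound f (‖z‖ + ρ)
  exact Summable.of_norm_bounded (summable_geometric_two.mul_left (C * M))
    (h _ f.2 z M fun w hw => hM w (closedBall_subset_closedBall_zero le_rfl hw))

theorem differentiable_diffOp {Φ : ℂ → ℂ} (hΦ : IsExponentialType Φ) (f : EntireFunction) :
    Differentiable ℂ fun z : ℂ =>
      ∑' k : ℕ, taylorCoeffZero Φ k * iteratedDeriv k (f : C(ℂ, ℂ)) z := by
  obtain ⟨C, ρ, hC, hρ, h⟩ := hΦ.norm_term_le
  intro z
  obtain ⟨M, hM⟩ := EntireFunction.exists_bound f (‖z‖ + 1 + ρ)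
  have hf : ContDiff ℂ ⊤ ((f : C(ℂ, ℂ)) : ℂ → ℂ) := Differentiable.contDiff f.2
  have key := Complex.differentiableOn_tsum_of_summable_norm
    (U := ball (0 : ℂ) (‖z‖ + 1))
    (F := fun (k : ℕ) (z : ℂ) => taylorCoeffZero Φ k * iteratedDeriv k (f : C(ℂ, ℂ)) z)
    (summable_geometric_two.mul_left (C * M))
    (fun k => ((hf.differentiable_iteratedDeriv k (by simp)).const_mul _).differentiableOn)
    isOpen_ball
    (fun k w hw => h _ f.2 w M (fun v hv => hM v (closedBall_subset_closedBall_zero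
      (mem_ball_zero_iff.1 hw).le hv)) k)
  exact key.differentiableAt (isOpen_ball.mem_nhds (by simp))

/-- The linear map `f ↦ ∑ aₖ f⁽ᵏ⁾` on `H(ℂ)`, where `Φ(z) = ∑ aₖ zᵏ` is of exponential type. -/
noncomputable def diffOpLinear (Φ : ℂ → ℂ) (hΦ : IsExponentialType Φ) :
    EntireFunction →ₗ[ℂ] EntireFunction where
  toFun f := ⟨⟨fun z => ∑' k : ℕ, taylorCoeffZero Φ k * iteratedDeriv k (f : C(ℂ, ℂ)) z,
    (differentiable_diffOp hΦ f).continuous⟩, differentiable_diffOp hΦ f⟩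
  map_add' f g := by
    ext z
    have hf : ContDiff ℂ ⊤ ((f : C(ℂ, ℂ)) : ℂ → ℂ) := Differentiable.contDiff f.2
    have hg : ContDiff ℂ ⊤ ((g : C(ℂ, ℂ)) : ℂ → ℂ) := Differentiable.contDiff g.2
    have h := (summable_diffOp hΦ f z).tsum_add (summable_diffOp hΦ g z)
    refine Eq.trans (tsum_congr fun k => ?_) h
    rw [← mul_add]
    congr 1
    exact iteratedDeriv_add (hf.of_le le_top).contDiffAt (hg.of_le le_top).contDiffAt
  map_smul' c f := by
    ext z
    have h := (summable_diffOp hΦ f z).tsum_mul_left c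
    refine Eq.trans (tsum_congr fun k => ?_) h
    have h2 : iteratedDeriv k (c • ((f : C(ℂ, ℂ)) : ℂ → ℂ)) z =
      c • iteratedDeriv k ((f : C(ℂ, ℂ)) : ℂ → ℂ) z := iteratedDeriv_const_smul_field c _
    rw [smul_eq_mul] at h2
    rw [mul_left_comm, ← h2]
    rfl

theorem continuous_diffOpLinear (Φ : ℂ → ℂ) (hΦ : IsExponentialType Φ) :
    Continuous (diffOpLinear Φ hΦ) := by
  obtain ⟨C, ρ, hC, hρ, h⟩ := hΦ.norm_term_le
  refine continuous_of_continuousAt_zero (diffOpLinear Φ hΦ) ?_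
  rw [ContinuousAt, map_zero, tendsto_subtype_rng,
    ContinuousMap.tendsto_iff_forall_isCompact_tendstoUniformlyOn]
  intro K hK
  obtain ⟨r, hr⟩ := hK.isBounded.subset_closedBall (0 : ℂ)
  have h0 : Tendsto (fun f : EntireFunction => (f : C(ℂ, ℂ))) (𝓝 0) (𝓝 0) :=
    continuous_subtype_val.tendsto' _ _ rfl
  rw [ContinuousMap.tendsto_iff_forall_isCompact_tendstoUniformlyOn] at h0
  have h1 := h0 _ (isCompact_closedBall (0 : ℂ) (r + ρ))
  rw [Metric.tendstoUniformlyOn_iff] at h1 ⊢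
  intro ε hε
  filter_upwards [h1 (ε / (4 * C)) (by positivity)] with f hf z hz
  have hz' : ‖z‖ ≤ r := mem_closedBall_zero_iff.1 (hr hz)
  have hb := h _ f.2 z (ε / (4 * C)) fun w hw => by
    have h2 := hf w (closedBall_subset_closedBall_zero hz' hw)
    simpa using h2.le
  have hs := (summable_geometric_two.mul_left (C * (ε / (4 * C))))
  have h3 := tsum_of_norm_bounded
    (hs.hasSum) hb
  rw [tsum_mul_left, tsum_geometric_two] at h3
  have h4 : C * (ε / (4 * C)) * 2 < ε := by
    have : C * (ε / (4 * C)) * 2 = ε / 2 := by field_simp; norm_num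
    linarith
  have h5 : ‖((diffOpLinear Φ hΦ f : EntireFunction) : C(ℂ, ℂ)) z‖ < ε := lt_of_le_of_lt h3 h4
  simpa using h5

/-- The differential (convolution) operator `Φ(D)` on `H(ℂ)`,
`(Φ(D) f)(z) = ∑ aₖ f⁽ᵏ⁾(z)`, for `Φ(z) = ∑ aₖ zᵏ` entire of exponential type. -/
noncomputable def diffOp (Φ : ℂ → ℂ) (hΦ : IsExponentialType Φ) :
    EntireFunction →L[ℂ] EntireFunction :=
  ⟨diffOpLinear Φ hΦ, continuous_diffOpLinear Φ hΦ⟩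

/-- The lower density of a set of positive integers, `liminf card (A ∩ {1, …, n}) / n`. -/
noncomputable def lowerDensity (A : Set ℕ) : ℝ :=
  liminf (fun n : ℕ => ((A ∩ Set.Icc 1 n).ncard : ℝ) / (n : ℝ)) atTop

/-- The sequence `(T n)` with `n ≥ 1` is frequently hypercyclic: some vector `x` has
`{n : T n x ∈ U}` of positive lower density for every nonempty open `U`
(`lowerDensity` only looks at indices `n ≥ 1`). -/
def IsFrequentlyHypercyclic {X Y : Type*} [AddCommMonoid X] [Module ℂ X] [TopologicalSpace X]
    [AddCommMonoid Y] [Module ℂ Y] [TopologicalSpace Y] (T : ℕ → X →L[ℂ] Y) : Prop :=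
  ∃ x : X, ∀ U : Set Y, IsOpen U → U.Nonempty → 0 < lowerDensity {n : ℕ | T n x ∈ U}

/-- The closed annulus centered at the origin determined by three radii. -/
def closedAnnulus (R₁ R₂ R₃ : ℝ) : Set ℂ :=
  {z | min R₁ (min R₂ R₃) ≤ ‖z‖ ∧ ‖z‖ ≤ max R₁ (max R₂ R₃)}

/-- The minimum of `|Φ(t)|` over the circle `|t| = R` (attained if `R > 0`, `Φ` continuous). -/
noncomputable def minOnCircle (Φ : ℂ → ℂ) (R : ℝ) : ℝ :=
  sInf ((fun t : ℂ => ‖Φ t‖) '' sphere (0 : ℂ) R)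

/-!
The operators `Φₙ(D)` have the exponentials `e ^ (z t)` as common eigenvectors, with eigenvalues
`Φₙ(t)`. Superpositions `(2πi)⁻¹ ∮ e ^ (z t) g(t) dt` over circles, with `g` holomorphic off the
origin, are dense in `H(ℂ)` (`dense_expIntegralSubmodule`), since `g(t) = k! / t ^ (k + 1)` gives
`z ^ k`. On such a function `Φₙ(D)` multiplies `g` by `Φₙ` (`diffOp_expIntegralEntire`), so dividing
`g` by `Φₙ` gives a right inverse `Sₙ` of `Φₙ(D)`. As no `Φₙ` vanishes in the annulus, the integral
for `Φₙ(D) Sₘ y`, whose density is `g Φₙ / Φₘ`, may be taken over the first circle as well as over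
the second (`expIntegral_eq_of_differentiableAt`); the first is used for `m ≤ n` and the second for
`n ≤ m`.

The sums of the `α` and `β` are only assumed bounded, not uniformly convergent. For a fixed `t`,
however, the quotients `|Φₙ(t)| / |Φⱼ(t)|` are multiplicative, and for them bounded sums force uniform
geometric decay, as in Datko's theorem on evolution families (`le_geometric_of_sum_ratio_le`,
`le_geometric_of_tsum_ratio_le`). Hence `Φₙ(D) Sₘ y` is of size `ρ ^ |n - m|` for some `ρ < 1`, up to
a factor depending on `y` and one depending on the disc.

With such decay a frequently hypercyclic vector is a series `∑ S_{n(k)} y_{p(k)}`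
(`isFrequentlyHypercyclic_of_geometric_decay`). The times `n(k)` (`rulerTime`) grow linearly, and
those at which the index `k + 1` has a given 2-adic valuation `v` form a set of positive lower density,
while two times of valuations `v` and `v'` are more than `v + v'` apart. The vector used at the time
`n(k)` depends only on the valuation `v` of `k + 1`. It is chosen small relative to `ρ ^ (-v)`, so all
terms but the `k`-th contribute `O(ρ ^ v)` to the image under the `n(k)`-th operator. Each vector of a
dense sequence is used for infinitely many `v`.
-/

/-! ### Geometric decay from bounded sums of ratios -/

/-- Discrete Datko lemma, forward form. The partial sums of `1 / x j` up to `n` exceed those up to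
`n - 1` by a factor `1 + 1 / C`, so the sequence `x` decays geometrically. -/
theorem le_geometric_of_sum_ratio_le {x : ℕ → ℝ} (hx : ∀ n, 0 < x n) {C : ℝ} (hC : 0 < C)
    (h : ∀ n, ∑ j ∈ Finset.range n, x n / x j ≤ C) {j n : ℕ} (hjn : j ≤ n) :
    x n / x j ≤ (C + 1) * (C / (C + 1)) ^ (n - j) := by
  set s : ℕ → ℝ := fun n => ∑ i ∈ Finset.range n, 1 / x i with hs
  have hsx : ∀ n, s n * x n ≤ C := fun n => by
    refine le_trans (le_of_eq ?_) (h n)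
    rw [hs, Finset.sum_mul]
    exact Finset.sum_congr rfl fun i _ => by ring
  have hsucc : ∀ n, s (n + 1) = s n + 1 / x n := fun n => Finset.sum_range_succ _ _
  have hspos : ∀ n, 0 ≤ s n := fun n => Finset.sum_nonneg fun i _ => by
    have := hx i
    positivity
  have hstep : ∀ n, s n ≤ C / (C + 1) * s (n + 1) := fun n => by
    have h1 : s n ≤ C * (1 / x n) := by
      rw [mul_one_div, le_div_iff₀ (hx n)]
      exact hsx n
    rw [div_mul_eq_mul_div, le_div_iff₀ (by positivity), hsucc]
    linarith
  have hgeo : ∀ k, s (j + 1) ≤ (C / (C + 1)) ^ k * s (j + k + 1) := by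
    intro k
    induction k with
    | zero => simp
    | succ k ih =>
      refine ih.trans ?_
      rw [pow_succ, mul_assoc]
      exact mul_le_mul_of_nonneg_left (hstep _) (by positivity)
  have h1 := hgeo (n - j)
  rw [Nat.add_sub_cancel' hjn] at h1
  have hlow : 1 / x j ≤ s (j + 1) := by
    rw [hsucc]
    linarith [hspos j]
  have hup : s (n + 1) * x n ≤ C + 1 := by
    rw [hsucc, add_mul, one_div, inv_mul_cancel₀ (hx n).ne']
    linarith [hsx n]
  calc x n / x j = 1 / x j * x n := by ring
    _ ≤ (C / (C + 1)) ^ (n - j) * s (n + 1) * x n :=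
        mul_le_mul_of_nonneg_right (hlow.trans h1) (hx n).le
    _ = (s (n + 1) * x n) * (C / (C + 1)) ^ (n - j) := by ring
    _ ≤ _ := mul_le_mul_of_nonneg_right hup (by positivity)

/-- Discrete Datko lemma, backward form: the tails of the series of `1 / x n` shrink by a factor
`C / (C + 1)` at each step. -/
theorem le_geometric_of_tsum_ratio_le {x : ℕ → ℝ} (hx : ∀ n, 0 < x n) {C : ℝ} (hC : 0 < C)
    (h : ∀ j, Summable (fun m => x j / x (j + 1 + m)) ∧ ∑' m, x j / x (j + 1 + m) ≤ C)
    {j n : ℕ} (hjn : j ≤ n) :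
    x j / x n ≤ (C + 1) * (C / (C + 1)) ^ (n - j) := by
  have hsum : ∀ j, Summable fun m => 1 / x (j + m) := fun j => by
    have h0 : Summable fun m => 1 / x (m + 1) := by
      have h1 := (h 0).1.mul_left (1 / x 0)
      refine h1.congr fun m => ?_
      have := (hx 0).ne'
      rw [show 0 + 1 + m = m + 1 by ring]
      field_simp
    have h1 := (summable_nat_add_iff (f := fun m => 1 / x m) 1).1 h0
    simpa only [add_comm] using (summable_nat_add_iff (f := fun m => 1 / x m) j).2 h1
  set τ : ℕ → ℝ := fun j => ∑' m, 1 / x (j + m) with hτ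
  have hsucc : ∀ j, τ j = 1 / x j + τ (j + 1) := fun j => by
    have := (hsum j).tsum_eq_zero_add
    simp only [hτ, add_zero] at this ⊢
    rw [this]
    congr 2
    ext m
    rw [add_assoc, add_comm 1 m]
  have hτpos : ∀ j, 0 ≤ τ j := fun j => tsum_nonneg fun i => by
    have := hx (j + i)
    positivity
  have hτx : ∀ j, x j * τ (j + 1) ≤ C := fun j => by
    refine le_trans (le_of_eq ?_) (h j).2
    rw [hτ, ← tsum_mul_left]
    exact tsum_congr fun i => by ring
  have hstep : ∀ j, τ (j + 1) ≤ C / (C + 1) * τ j := fun j => by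
    have h1 : τ (j + 1) ≤ C * (1 / x j) := by
      rw [mul_one_div, le_div_iff₀ (hx j), mul_comm]
      exact hτx j
    rw [div_mul_eq_mul_div, le_div_iff₀ (by positivity), hsucc j]
    linarith
  have hgeo : ∀ k, τ (j + k) ≤ (C / (C + 1)) ^ k * τ j := by
    intro k
    induction k with
    | zero => simp
    | succ k ih =>
      refine (hstep (j + k)).trans ?_
      rw [pow_succ', mul_assoc]
      exact mul_le_mul_of_nonneg_left ih (by positivity)
  have h1 := hgeo (n - j)
  rw [Nat.add_sub_cancel' hjn] at h1
  have hlow : 1 / x n ≤ τ n := by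
    rw [hsucc]
    linarith [hτpos (n + 1)]
  have hup : x j * τ j ≤ C + 1 := by
    rw [hsucc, mul_add, one_div, mul_inv_cancel₀ (hx j).ne']
    linarith [hτx j]
  calc x j / x n = x j * (1 / x n) := by ring
    _ ≤ x j * ((C / (C + 1)) ^ (n - j) * τ j) :=
        mul_le_mul_of_nonneg_left (hlow.trans h1) (hx j).le
    _ = (x j * τ j) * (C / (C + 1)) ^ (n - j) := by ring
    _ ≤ _ := mul_le_mul_of_nonneg_right hup (by positivity)

/-! ### A sequence of times separated according to 2-adic valuations -/

/-- The `k`-th time carries the weight `v = padicValNat 2 (k + 1)`; it is the midpoint of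
the `k`-th of consecutive blocks, whose length is `2 v + 1`, so that times of weights `v` and `v'`
are at distance greater than `v + v'`. -/
def rulerTime (k : ℕ) : ℕ :=
  ∑ i ∈ Finset.range k, (2 * padicValNat 2 (i + 1) + 1) + padicValNat 2 (k + 1) + 1

theorem rulerTime_add_le {k l : ℕ} (h : k < l) :
    rulerTime k + padicValNat 2 (k + 1) + padicValNat 2 (l + 1) + (l - k) ≤ rulerTime l := by
  have key : ∀ d, ∑ i ∈ Finset.range k, (2 * padicValNat 2 (i + 1) + 1) +
      2 * padicValNat 2 (k + 1) + (d + 1) ≤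
      ∑ i ∈ Finset.range (k + d + 1), (2 * padicValNat 2 (i + 1) + 1) := by
    intro d
    induction d with
    | zero => rw [add_zero, Finset.sum_range_succ]; omega
    | succ d ih => rw [← add_assoc k d 1, Finset.sum_range_succ]; omega
  have h1 := key (l - k - 1)
  rw [show k + (l - k - 1) + 1 = l by omega] at h1
  unfold rulerTime
  omega

theorem add_le_rulerTime (k : ℕ) : padicValNat 2 (k + 1) + k + 1 ≤ rulerTime k := by
  have h : ∑ i ∈ Finset.range k, 1 ≤ ∑ i ∈ Finset.range k, (2 * padicValNat 2 (i + 1) + 1) :=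
    Finset.sum_le_sum fun i _ => by omega
  rw [Finset.sum_const, Finset.card_range, smul_eq_mul, mul_one] at h
  unfold rulerTime
  omega

/-- By Legendre's formula the valuations of `1, …, k + 1` sum to at most `k + 1`. -/
theorem rulerTime_le (k : ℕ) : rulerTime k ≤ 3 * (k + 1) := by
  have key : ∀ n, ∑ i ∈ Finset.range n, (2 * padicValNat 2 (i + 1) + 1) =
      2 * padicValNat 2 n.factorial + n := by
    intro n
    induction n with
    | zero => simp
    | succ n ih =>
      rw [Finset.sum_range_succ, ih, Nat.factorial_succ,
        padicValNat.mul (Nat.succ_ne_zero n) n.factorial_ne_zero]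
      ring
  have h1 := key (k + 1)
  have h2 : (2 - 1) * padicValNat 2 (k + 1).factorial < k + 1 :=
    sub_one_mul_padicValNat_factorial_lt_of_ne_zero 2 k.succ_ne_zero
  rw [Finset.sum_range_succ] at h1
  unfold rulerTime
  omega

theorem rulerTime_strictMono : StrictMono rulerTime := fun k l h => by
  have := rulerTime_add_le h
  omega

theorem padicValNat_two_pow_mul_odd (v j : ℕ) : padicValNat 2 (2 ^ v * (2 * j + 1)) = v := by
  rw [padicValNat.mul (by positivity) (by omega), padicValNat.prime_pow,
    padicValNat.eq_zero_of_not_dvd (by omega), add_zero]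

/-! ### Positive lower density -/

theorem lowerDensity_pos_of_le {A : Set ℕ} {M : ℕ} (hM : 0 < M)
    (h : ∀ n : ℕ, n / M ≤ (A ∩ Set.Icc 1 n).ncard) : 0 < lowerDensity A := by
  have hM' : (0 : ℝ) < M := by exact_mod_cast hM
  refine lt_of_lt_of_le (show (0 : ℝ) < 1 / (2 * M) by positivity) ?_
  refine le_liminf_of_le ?_ ?_
  · refine IsBoundedUnder.isCoboundedUnder_ge (isBoundedUnder_of ⟨1, fun n => ?_⟩)
    refine div_le_one_of_le₀ ?_ (Nat.cast_nonneg n)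
    have h1 : (A ∩ Set.Icc 1 n).ncard ≤ (Set.Icc 1 n).ncard :=
      Set.ncard_le_ncard Set.inter_subset_right (Set.finite_Icc 1 n)
    rw [← Finset.coe_Icc, Set.ncard_coe_finset, Nat.card_Icc, Nat.add_sub_cancel,
      Finset.coe_Icc] at h1
    exact_mod_cast h1
  · filter_upwards [eventually_ge_atTop M] with n hn
    have hn0 : (0 : ℝ) < n := by exact_mod_cast lt_of_lt_of_le hM hn
    rw [div_le_div_iff₀ (by positivity) hn0]
    -- `n < 2 M ⌊n / M⌋` because `⌊n / M⌋ ≥ 1`.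
    have h1 : n ≤ 2 * M * (n / M) := by
      have h2 := Nat.div_add_mod n M
      have h3 := Nat.mod_lt n hM
      have h4 : 1 ≤ n / M := (Nat.one_le_div_iff hM).2 hn
      nlinarith
    have h2 : n ≤ 2 * M * (A ∩ Set.Icc 1 n).ncard := h1.trans (Nat.mul_le_mul_left _ (h n))
    have h3 : (n : ℝ) ≤ 2 * M * (A ∩ Set.Icc 1 n).ncard := by exact_mod_cast h2
    linarith

/-- The times of a given weight form a set of positive lower density. -/
theorem lowerDensity_pos_of_rulerTime_mem {A : Set ℕ} (v : ℕ)
    (h : ∀ k, padicValNat 2 (k + 1) = v → rulerTime k ∈ A) : 0 < lowerDensity A := by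
  refine lowerDensity_pos_of_le (M := 6 * 2 ^ v) (by positivity) fun n => ?_
  -- The indices `k = 2 ^ v * (2 j + 1) - 1` have weight `v`.
  set φ : ℕ → ℕ := fun j => rulerTime (2 ^ v * (2 * j + 1) - 1) with hφ
  have hpos : ∀ j, 2 ^ v * (2 * j + 1) - 1 + 1 = 2 ^ v * (2 * j + 1) := fun j =>
    Nat.sub_add_cancel (Nat.succ_le_of_lt (by positivity))
  have hinj : Function.Injective φ := fun i j hij => by
    have h1 := rulerTime_strictMono.injective hij
    have h2 : 2 ^ v * (2 * i + 1) = 2 ^ v * (2 * j + 1) := by rw [← hpos i, ← hpos j, h1]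
    have h3 := Nat.eq_of_mul_eq_mul_left (by positivity) h2
    omega
  have hsub : ((Finset.range (n / (6 * 2 ^ v))).image φ : Set ℕ) ⊆ A ∩ Set.Icc 1 n := by
    intro m hm
    rw [Finset.coe_image] at hm
    obtain ⟨j, hj, rfl⟩ := hm
    have hj' : j + 1 ≤ n / (6 * 2 ^ v) := Finset.mem_range.1 (Finset.mem_coe.1 hj)
    refine ⟨h _ (by rw [hpos, padicValNat_two_pow_mul_odd]), ?_, ?_⟩
    · have := add_le_rulerTime (2 ^ v * (2 * j + 1) - 1)
      simp only [hφ]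
      omega
    · have h1 := rulerTime_le (2 ^ v * (2 * j + 1) - 1)
      rw [hpos] at h1
      have h2 := (Nat.le_div_iff_mul_le (by positivity)).1 hj'
      refine h1.trans (le_trans ?_ h2)
      have : 0 < 2 ^ v := by positivity
      nlinarith
  have h1 := Set.ncard_le_ncard hsub ((Set.finite_Icc 1 n).inter_of_right A)
  rwa [Set.ncard_coe_finset, Finset.card_image_of_injective _ hinj, Finset.card_range] at h1

/-! ### The topology of `H(ℂ)` -/

theorem EntireFunction.exists_forall_norm_sub_lt_imp_mem {U : Set EntireFunction} (hU : IsOpen U)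
    {y : EntireFunction} (hy : y ∈ U) :
    ∃ r ε : ℝ, 0 < ε ∧ ∀ f : EntireFunction,
      (∀ z : ℂ, ‖z‖ ≤ r → ‖(f : C(ℂ, ℂ)) z - (y : C(ℂ, ℂ)) z‖ < ε) → f ∈ U := by
  obtain ⟨W, hW, rfl⟩ := isOpen_induced_iff.1 hU
  obtain ⟨V, hV, hVW⟩ := UniformSpace.mem_nhds_iff.1 (hW.mem_nhds hy)
  obtain ⟨K, S, hK, hS, hKS⟩ := (ContinuousMap.mem_compactConvergence_entourage_iff V).1 hV
  obtain ⟨r, hr⟩ := hK.isBounded.subset_closedBall (0 : ℂ)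
  obtain ⟨ε, hε, hεS⟩ := Metric.mem_uniformity_dist.1 hS
  refine ⟨r, ε, hε, fun f hf => hVW (hKS ?_)⟩
  intro z hz
  refine hεS ?_
  rw [dist_comm, dist_eq_norm]
  exact hf z (mem_closedBall_zero_iff.1 (hr hz))

/-- Weierstrass M-test in `H(ℂ)`, with majorants on all closed discs. -/
theorem EntireFunction.summable_of_norm_le {f : ℕ → EntireFunction}
    (h : ∀ r : ℝ, ∃ u : ℕ → ℝ, Summable u ∧
      ∀ n, ∀ z : ℂ, ‖z‖ ≤ r → ‖(f n : C(ℂ, ℂ)) z‖ ≤ u n) : Summable f := by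
  have hd : Differentiable ℂ fun z => ∑' n, (f n : C(ℂ, ℂ)) z := by
    intro z
    obtain ⟨u, hu, hfu⟩ := h (‖z‖ + 1)
    have key := Complex.differentiableOn_tsum_of_summable_norm (U := ball (0 : ℂ) (‖z‖ + 1))
      (F := fun n z => (f n : C(ℂ, ℂ)) z) hu (fun n => (f n).2.differentiableOn) isOpen_ball
      (fun n w hw => hfu n w (mem_ball_zero_iff.1 hw).le)
    exact key.differentiableAt (isOpen_ball.mem_nhds (by simp))
  refine ⟨⟨⟨_, hd.continuous⟩, hd⟩, ?_⟩
  unfold HasSum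
  rw [tendsto_subtype_rng, ContinuousMap.tendsto_iff_forall_isCompact_tendstoUniformlyOn]
  intro K hK
  obtain ⟨r, hr⟩ := hK.isBounded.subset_closedBall (0 : ℂ)
  obtain ⟨u, hu, hfu⟩ := h r
  refine (tendstoUniformlyOn_tsum (f := fun n z => (f n : C(ℂ, ℂ)) z) hu
    fun n z hz => hfu n z (mem_closedBall_zero_iff.1 (hr hz))).congr ?_
  refine Eventually.of_forall fun s z _ => ?_
  simp

/-- Evaluation at a point, as a continuous linear functional on `H(ℂ)`. -/
noncomputable def EntireFunction.evalCLM (z : ℂ) : EntireFunction →L[ℂ] ℂ where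
  toFun f := (f : C(ℂ, ℂ)) z
  map_add' _ _ := rfl
  map_smul' _ _ := rfl
  cont := (continuous_eval_const z).comp continuous_subtype_val

theorem EntireFunction.evalCLM_apply (z : ℂ) (f : EntireFunction) :
    EntireFunction.evalCLM z f = (f : C(ℂ, ℂ)) z := rfl

/-- The monomial `z ^ n` as an element of `H(ℂ)`. -/
def EntireFunction.monomial (n : ℕ) : EntireFunction :=
  ⟨⟨fun z => z ^ n, continuous_pow n⟩, differentiable_pow n⟩

/-- A closed subspace containing all monomials contains the Taylor series of every entire
function. -/
theorem EntireFunction.dense_of_monomial_mem (V : Submodule ℂ EntireFunction)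
    (hV : ∀ n, EntireFunction.monomial n ∈ V) : Dense (V : Set EntireFunction) := by
  intro f
  have hd : Differentiable ℂ (f : C(ℂ, ℂ)) := f.2
  set c : ℕ → ℂ := fun n => (n.factorial : ℂ)⁻¹ * iteratedDeriv n (f : C(ℂ, ℂ)) 0 with hc
  have hf : ∀ z : ℂ, HasSum (fun n => c n * z ^ n) ((f : C(ℂ, ℂ)) z) := fun z => by
    refine (Complex.hasSum_taylorSeries_of_entire hd 0 z).congr_fun ?_
    intro n
    simp only [hc, sub_zero, smul_eq_mul]
    ring
  clear_value c
  have hs : Summable fun n => c n • EntireFunction.monomial n := by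
    refine EntireFunction.summable_of_norm_le fun r => ?_
    refine ⟨fun n => ‖c n * (|r| : ℝ) ^ n‖, (hf (|r| : ℝ)).summable.norm, fun n z hz => ?_⟩
    have : (c n • EntireFunction.monomial n : EntireFunction).1 z = c n * z ^ n := rfl
    change _ ≤ ‖c n * _‖
    rw [this, norm_mul, norm_mul, norm_pow, norm_pow, Complex.norm_real, Real.norm_eq_abs, abs_abs]
    gcongr
    exact hz.trans (le_abs_self r)
  obtain ⟨g, hg⟩ := hs
  have hfg : g = f := by
    ext z
    have h1 := (EntireFunction.evalCLM z).hasSum hg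
    exact h1.unique (hf z)
  rw [← hfg]
  refine mem_closure_of_tendsto hg (Eventually.of_forall fun s => ?_)
  exact V.sum_mem fun n _ => V.smul_mem _ (hV n)

/-! ### A frequent hypercyclicity criterion -/

/-- The sums of `ρ ^ |k - l|` over `l` are bounded uniformly in `k`. -/
theorem exists_tsum_pow_dist_le {ρ : ℝ} (h0 : 0 ≤ ρ) (h1 : ρ < 1) :
    ∃ B : ℝ, ∀ k : ℕ, Summable (fun l : ℕ => ρ ^ ((l : ℤ) - k).natAbs) ∧
      ∑' l : ℕ, ρ ^ ((l : ℤ) - k).natAbs ≤ B := by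
  have hs : Summable fun n : ℤ => ρ ^ n.natAbs := by
    refine Summable.of_nat_of_neg ?_ ?_ <;>
      simpa using summable_geometric_of_lt_one h0 h1
  refine ⟨∑' n : ℤ, ρ ^ n.natAbs, fun k => ?_⟩
  have hinj : Function.Injective fun l : ℕ => (l : ℤ) - k := fun a b hab => by
    simpa using hab
  exact ⟨hs.comp_injective hinj,
    tsum_comp_le_tsum_of_inj hs (fun n => pow_nonneg h0 _) hinj⟩

/-- Frequent hypercyclicity from approximate right inverses with off-diagonal geometric decay.
The vectors `y p` are dense, `S m p` is a preimage of `y p` under `T m`, and `T n (S m p)` is of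
size `ρ ^ |n - m|`, up to a factor `E r` depending only on the disc and a factor `G p` depending
only on `p`. A frequently hypercyclic vector is `∑ₖ S (rulerTime k) p(k)`, where `p(k)` depends
only on the weight `v` of the `k`-th time: the separation of the times makes the error at that time
at most a constant times `ρ ^ v`, once `G p(k) * ρ ^ v ≤ 1`. -/
theorem isFrequentlyHypercyclic_of_geometric_decay
    (T : ℕ → EntireFunction →L[ℂ] EntireFunction) {y : ℕ → EntireFunction} (hy : DenseRange y)
    (S : ℕ → ℕ → EntireFunction) {G : ℕ → ℝ} (hG : ∀ p, 0 ≤ G p)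
    {E : ℝ → ℝ} (hE : ∀ r, 0 ≤ E r) {ρ : ℝ} (hρ0 : 0 < ρ) (hρ1 : ρ < 1)
    (hTS : ∀ n p, 1 ≤ n → T n (S n p) = y p)
    (hS : ∀ n p r, 1 ≤ n → ∀ z : ℂ, ‖z‖ ≤ r →
      ‖(S n p : C(ℂ, ℂ)) z‖ ≤ E r * G p * ρ ^ n)
    (hTSdist : ∀ n m p r, 1 ≤ n → 1 ≤ m → ∀ z : ℂ, ‖z‖ ≤ r →
      ‖(T n (S m p) : C(ℂ, ℂ)) z‖ ≤ E r * G p * ρ ^ ((m : ℤ) - n).natAbs) :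
    IsFrequentlyHypercyclic T := by
  classical
  obtain ⟨B, hB⟩ := exists_tsum_pow_dist_le hρ0.le hρ1
  set w : ℕ → ℕ := fun k => padicValNat 2 (k + 1) with hw
  have hn1 : ∀ k, 1 ≤ rulerTime k := fun k => le_trans (by omega) (add_le_rulerTime k)
  set u : ℕ → EntireFunction := fun k =>
    if G (w k).unpair.1 * ρ ^ w k ≤ 1 then S (rulerTime k) (w k).unpair.1 else 0 with hu
  have hu_norm : ∀ r k, ∀ z : ℂ, ‖z‖ ≤ r → ‖(u k : C(ℂ, ℂ)) z‖ ≤ E r * ρ ^ k := by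
    intro r k z hz
    simp only [hu]
    split_ifs with hk
    · refine (hS _ _ r (hn1 k) z hz).trans ?_
      have h1 : ρ ^ rulerTime k ≤ ρ ^ w k * ρ ^ k := by
        rw [← pow_add]
        exact pow_le_pow_of_le_one hρ0.le hρ1.le ((Nat.le_succ _).trans (add_le_rulerTime k))
      calc E r * G (w k).unpair.1 * ρ ^ rulerTime k
          ≤ E r * G (w k).unpair.1 * (ρ ^ w k * ρ ^ k) := by
            gcongr
            exact mul_nonneg (hE r) (hG _)
        _ = E r * (G (w k).unpair.1 * ρ ^ w k) * ρ ^ k := by ring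
        _ ≤ E r * 1 * ρ ^ k := by
            gcongr
            exact hE r
        _ = E r * ρ ^ k := by ring
    · have : ((0 : EntireFunction) : C(ℂ, ℂ)) z = 0 := rfl
      rw [this, norm_zero]
      exact mul_nonneg (hE r) (pow_nonneg hρ0.le k)
  obtain ⟨f, hf⟩ : Summable u := EntireFunction.summable_of_norm_le fun r =>
    ⟨fun k => E r * ρ ^ k, (summable_geometric_of_lt_one hρ0.le hρ1).mul_left _, hu_norm r⟩
  have hoff : ∀ r k l, l ≠ k → ∀ z : ℂ, ‖z‖ ≤ r →
      ‖(T (rulerTime k) (u l) : C(ℂ, ℂ)) z‖ ≤ E r * ρ ^ w k * ρ ^ ((l : ℤ) - k).natAbs := by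
    intro r k l hlk z hz
    simp only [hu]
    split_ifs with hl
    · refine (hTSdist _ _ _ r (hn1 k) (hn1 l) z hz).trans ?_
      have hd : w l + (w k + ((l : ℤ) - k).natAbs) ≤
          ((rulerTime l : ℤ) - rulerTime k).natAbs := by
        rcases lt_or_gt_of_ne hlk with h | h
        · have := rulerTime_add_le h
          simp only [hw]
          omega
        · have := rulerTime_add_le h
          simp only [hw]
          omega
      have h1 := pow_le_pow_of_le_one hρ0.le hρ1.le hd
      rw [pow_add, pow_add] at h1
      calc _ ≤ E r * G (w l).unpair.1 * (ρ ^ w l * (ρ ^ w k * ρ ^ ((l : ℤ) - k).natAbs)) := by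
            gcongr
            exact mul_nonneg (hE r) (hG _)
        _ = E r * (G (w l).unpair.1 * ρ ^ w l) * (ρ ^ w k * ρ ^ ((l : ℤ) - k).natAbs) := by ring
        _ ≤ E r * 1 * (ρ ^ w k * ρ ^ ((l : ℤ) - k).natAbs) := by
            gcongr
            exact hE r
        _ = _ := by ring
    · rw [map_zero]
      have : ((0 : EntireFunction) : C(ℂ, ℂ)) z = 0 := rfl
      rw [this, norm_zero]
      have := hE r
      positivity
  have herr : ∀ r k, G (w k).unpair.1 * ρ ^ w k ≤ 1 → ∀ z : ℂ, ‖z‖ ≤ r →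
      ‖(T (rulerTime k) f : C(ℂ, ℂ)) z - (y (w k).unpair.1 : C(ℂ, ℂ)) z‖ ≤
        E r * ρ ^ w k * B := by
    intro r k hk z hz
    have h1 := ((EntireFunction.evalCLM z).comp (T (rulerTime k))).hasSum hf
    have h2 := h1.sub (hasSum_ite_eq k ((y (w k).unpair.1 : C(ℂ, ℂ)) z))
    refine (h2.norm_le_of_bounded ((hB k).1.hasSum.mul_left (E r * ρ ^ w k)) fun l => ?_).trans
      (mul_le_mul_of_nonneg_left (hB k).2 (mul_nonneg (hE r) (pow_nonneg hρ0.le _)))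
    by_cases hl : l = k
    · have h3 : T (rulerTime k) (u k) = y (w k).unpair.1 := by
        simp only [hu, if_pos hk]
        exact hTS _ _ (hn1 k)
      have := hE r
      subst hl
      simp only [ContinuousLinearMap.comp_apply, h3,
        EntireFunction.evalCLM_apply, if_true, sub_self, norm_zero]
      positivity
    · simp only [if_neg hl, sub_zero]
      exact hoff r k l hl z hz
  refine ⟨f, fun U hU hUne => ?_⟩
  obtain ⟨p, hp⟩ := hy.exists_mem_open hU hUne
  obtain ⟨r, ε, hε, hrε⟩ := EntireFunction.exists_forall_norm_sub_lt_imp_mem hU hp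
  have hlim : Tendsto (fun m : ℕ => ρ ^ Nat.pair p m) atTop (𝓝 0) :=
    (tendsto_pow_atTop_nhds_zero_of_lt_one hρ0.le hρ1).comp
      (tendsto_atTop_mono (fun m => Nat.right_le_pair p m) tendsto_id)
  have h1 : ∀ᶠ m in atTop, G p * ρ ^ Nat.pair p m < 1 :=
    (hlim.const_mul (G p)).eventually_lt_const (by simp)
  have h2 : ∀ᶠ m in atTop, E r * B * ρ ^ Nat.pair p m < ε :=
    (hlim.const_mul (E r * B)).eventually_lt_const (by simpa)
  obtain ⟨m, hm1, hm2⟩ := (h1.and h2).exists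
  refine lowerDensity_pos_of_rulerTime_mem (Nat.pair p m) fun k hk => hrε _ fun z hz => ?_
  have hwk : w k = Nat.pair p m := hk
  have h3 := herr r k (by rw [hwk, Nat.unpair_pair]; exact hm1.le) z hz
  rw [hwk, Nat.unpair_pair] at h3
  exact h3.trans_lt (lt_of_eq_of_lt (by ring) hm2)

/-! ### Superpositions of exponentials over a circle -/

/-- The function `z ↦ (2πi)⁻¹ ∮ e ^ (z t) g(t) dt`, where `t` runs over the circle of radius `R`
about the origin. -/
noncomputable def expIntegral (R : ℝ) (g : ℂ → ℂ) (z : ℂ) : ℂ :=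
  (2 * Real.pi * Complex.I : ℂ)⁻¹ • ∮ t in C(0, R), Complex.exp (z * t) * g t

theorem continuous_comp_circleMap {R : ℝ} (hR : 0 ≤ R) {g : ℂ → ℂ}
    (hg : ContinuousOn g (sphere 0 R)) : Continuous fun θ : ℝ => g (circleMap 0 R θ) :=
  hg.comp_continuous (continuous_circleMap 0 R) fun θ => circleMap_mem_sphere 0 hR θ

theorem hasDerivAt_expIntegral {R : ℝ} (hR : 0 ≤ R) {g : ℂ → ℂ}
    (hg : ContinuousOn g (sphere 0 R)) (z : ℂ) :
    HasDerivAt (expIntegral R g) (expIntegral R (fun t => t * g t) z) z := by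
  have hgc := continuous_comp_circleMap hR hg
  have hcm := continuous_circleMap 0 R
  have hexp : ∀ x : ℂ, Continuous fun θ => Complex.exp (x * circleMap 0 R θ) := fun x => by
    fun_prop
  refine HasDerivAt.const_smul (2 * Real.pi * Complex.I : ℂ)⁻¹ ?_
  unfold circleIntegral
  simp only [deriv_circleMap]
  refine (intervalIntegral.hasDerivAt_integral_of_dominated_loc_of_deriv_le
    (F := fun x θ => (circleMap 0 R θ * Complex.I) •
      (Complex.exp (x * circleMap 0 R θ) * g (circleMap 0 R θ)))
    (F' := fun x θ => (circleMap 0 R θ * Complex.I) •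
      (Complex.exp (x * circleMap 0 R θ) * (circleMap 0 R θ * g (circleMap 0 R θ))))
    (bound := fun θ => R * (Real.exp ((‖z‖ + 1) * R) * (R * ‖g (circleMap 0 R θ)‖)))
    (ball_mem_nhds z one_pos) ?_ ?_ ?_ ?_ ?_ ?_).2
  · refine Eventually.of_forall fun x => Continuous.aestronglyMeasurable ?_
    exact (hcm.mul continuous_const).smul ((hexp x).mul hgc)
  · refine Continuous.intervalIntegrable ?_ _ _
    exact (hcm.mul continuous_const).smul ((hexp z).mul hgc)
  · refine Continuous.aestronglyMeasurable ?_
    exact (hcm.mul continuous_const).smul ((hexp z).mul (hcm.mul hgc))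
  · refine Eventually.of_forall fun θ _ x hx => ?_
    have hx' : ‖x‖ ≤ ‖z‖ + 1 := by
      rw [mem_ball, dist_eq_norm] at hx
      have := norm_add_le (x - z) z
      rw [sub_add_cancel] at this
      linarith
    have h1 : ‖circleMap 0 R θ‖ = R := by simp [abs_of_nonneg hR]
    have h2 : ‖Complex.exp (x * circleMap 0 R θ)‖ ≤ Real.exp ((‖z‖ + 1) * R) := by
      refine (Complex.norm_exp_le_exp_norm _).trans (Real.exp_le_exp.2 ?_)
      rw [norm_mul, h1]
      gcongr
    rw [norm_smul, norm_mul, norm_mul, norm_mul, h1, Complex.norm_I, mul_one]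
    gcongr
  · refine Continuous.intervalIntegrable ?_ _ _
    exact continuous_const.mul (continuous_const.mul (continuous_const.mul hgc.norm))
  · refine Eventually.of_forall fun θ _ x _ => ?_
    have h1 : HasDerivAt (fun x : ℂ => x * circleMap 0 R θ) (circleMap 0 R θ) x := by
      simpa using (hasDerivAt_id x).mul_const (circleMap 0 R θ)
    have h2 := (h1.cexp.mul_const (g (circleMap 0 R θ))).const_smul (circleMap 0 R θ * Complex.I)
    rwa [mul_assoc] at h2

theorem iteratedDeriv_expIntegral {R : ℝ} (hR : 0 ≤ R) (k : ℕ) {g : ℂ → ℂ}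
    (hg : ContinuousOn g (sphere 0 R)) :
    iteratedDeriv k (expIntegral R g) = expIntegral R fun t => t ^ k * g t := by
  induction k with
  | zero => simp
  | succ k ih =>
    rw [iteratedDeriv_succ, ih]
    ext z
    have hgk : ContinuousOn (fun t => t ^ k * g t) (sphere 0 R) :=
      (continuous_pow k).continuousOn.mul hg
    rw [(hasDerivAt_expIntegral hR hgk z).deriv]
    congr 1
    ext t
    ring

theorem norm_expIntegral_le {R : ℝ} (hR : 0 ≤ R) {g : ℂ → ℂ} {M : ℝ}
    (hM : ∀ t : ℂ, ‖t‖ = R → ‖g t‖ ≤ M) {r : ℝ} {z : ℂ} (hz : ‖z‖ ≤ r) :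
    ‖expIntegral R g z‖ ≤ R * (Real.exp (r * R) * M) := by
  refine circleIntegral.norm_two_pi_i_inv_smul_integral_le_of_norm_le_const hR fun t ht => ?_
  have ht' := mem_sphere_zero_iff_norm.1 ht
  rw [norm_mul]
  have h1 : ‖Complex.exp (z * t)‖ ≤ Real.exp (r * R) := by
    refine (Complex.norm_exp_le_exp_norm _).trans (Real.exp_le_exp.2 ?_)
    rw [norm_mul, ht']
    gcongr
  exact mul_le_mul h1 (hM t ht') (norm_nonneg _) (Real.exp_pos _).le

theorem expIntegral_congr {R : ℝ} (hR : 0 ≤ R) {g h : ℂ → ℂ} (hgh : ∀ t : ℂ, ‖t‖ = R → g t = h t)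
    (z : ℂ) : expIntegral R g z = expIntegral R h z := by
  unfold expIntegral
  congr 1
  refine circleIntegral.integral_congr hR fun t ht => ?_
  simp only [hgh t (mem_sphere_zero_iff_norm.1 ht)]

/-- Cauchy's theorem in an annulus: the circle of integration may be moved through the domain of
holomorphy of the density. -/
theorem expIntegral_eq_of_differentiableAt {r R : ℝ} (hr : 0 < r) (hR : 0 < R) {g : ℂ → ℂ}
    (hg : ∀ t : ℂ, min r R ≤ ‖t‖ → ‖t‖ ≤ max r R → DifferentiableAt ℂ g t) (z : ℂ) :
    expIntegral R g z = expIntegral r g z := by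
  wlog hle : r ≤ R generalizing r R
  · exact (this hR hr (by rwa [min_comm, max_comm]) (le_of_not_ge hle)).symm
  rw [min_eq_left hle, max_eq_right hle] at hg
  have hd : ∀ t : ℂ, r ≤ ‖t‖ → ‖t‖ ≤ R →
      DifferentiableAt ℂ (fun t => Complex.exp (z * t) * g t) t := fun t h1 h2 =>
    ((differentiableAt_id.const_mul z).cexp).mul (hg t h1 h2)
  unfold expIntegral
  rw [Complex.circleIntegral_eq_of_differentiable_on_annulus_off_countable hr hle
    Set.countable_empty]
  · rintro t ⟨h1, h2⟩
    rw [mem_closedBall_zero_iff] at h1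
    rw [mem_ball_zero_iff, not_lt] at h2
    exact (hd t h2 h1).continuousAt.continuousWithinAt
  · rintro t ⟨⟨h1, h2⟩, -⟩
    rw [mem_ball_zero_iff] at h1
    rw [mem_closedBall_zero_iff, not_le] at h2
    exact hd t h2.le h1.le

/-- `expIntegral R g` as an element of `H(ℂ)`. -/
noncomputable def expIntegralEntire {R : ℝ} (hR : 0 ≤ R) {g : ℂ → ℂ}
    (hg : ContinuousOn g (sphere 0 R)) : EntireFunction :=
  have hd : Differentiable ℂ (expIntegral R g) := fun z =>
    (hasDerivAt_expIntegral hR hg z).differentiableAt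
  ⟨⟨expIntegral R g, hd.continuous⟩, hd⟩

/-- The exponential `e ^ (z t)` is an eigenvector of `Φ(D)` with eigenvalue `Φ t`, hence `Φ(D)` acts
on superpositions of exponentials by multiplying the density by `Φ`. -/
theorem diffOp_expIntegralEntire {Φ : ℂ → ℂ} (hΦ : IsExponentialType Φ) {R : ℝ} (hR : 0 ≤ R)
    {g : ℂ → ℂ} (hg : ContinuousOn g (sphere 0 R)) (z : ℂ) :
    (diffOp Φ hΦ (expIntegralEntire hR hg) : C(ℂ, ℂ)) z =
      expIntegral R (fun t => Φ t * g t) z := by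
  have hgc := continuous_comp_circleMap hR hg
  have hcm := continuous_circleMap 0 R
  have hTaylor : ∀ t : ℂ, HasSum (fun k => taylorCoeffZero Φ k * t ^ k) (Φ t) := fun t => by
    refine (Complex.hasSum_taylorSeries_of_entire hΦ.1 0 t).congr_fun fun k => ?_
    simp only [taylorCoeffZero, sub_zero, smul_eq_mul]
    ring
  change ∑' k : ℕ, taylorCoeffZero Φ k * iteratedDeriv k (expIntegral R g) z = _
  simp only [iteratedDeriv_expIntegral hR _ hg]
  refine HasSum.tsum_eq ?_
  set d : ℝ → ℂ := fun θ => deriv (circleMap 0 R) θ *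
    (Complex.exp (z * circleMap 0 R θ) * g (circleMap 0 R θ)) with hd
  have hdc : Continuous d := by
    simp only [hd, deriv_circleMap]
    have hexp : Continuous fun θ => Complex.exp (z * circleMap 0 R θ) := by fun_prop
    exact (hcm.mul continuous_const).mul (hexp.mul hgc)
  have hsum : HasSum
      (fun k => ∫ θ in (0)..(2 * Real.pi), taylorCoeffZero Φ k * (circleMap 0 R θ) ^ k * d θ)
      (∫ θ in (0)..(2 * Real.pi), Φ (circleMap 0 R θ) * d θ) := by
    have hR' := (hTaylor (R : ℂ)).summable.norm
    refine intervalIntegral.hasSum_integral_of_dominated_convergence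
      (fun k θ => ‖taylorCoeffZero Φ k * (R : ℂ) ^ k‖ * ‖d θ‖) (fun k => ?_) (fun k => ?_) ?_ ?_ ?_
    · refine Continuous.aestronglyMeasurable ?_
      fun_prop
    · refine Eventually.of_forall fun θ _ => ?_
      simp [abs_of_nonneg hR]
    · exact Eventually.of_forall fun θ _ => hR'.mul_right _
    · simp only [tsum_mul_right]
      refine Continuous.intervalIntegrable ?_ _ _
      fun_prop
    · exact Eventually.of_forall fun θ _ => (hTaylor _).mul_right _
  have hsum' := hsum.const_smul (2 * Real.pi * Complex.I : ℂ)⁻¹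
  unfold expIntegral circleIntegral
  convert hsum' using 1
  · ext k
    rw [smul_eq_mul, smul_eq_mul, mul_left_comm, ← intervalIntegral.integral_const_mul]
    congr 1
    refine intervalIntegral.integral_congr fun θ _ => ?_
    simp only [hd, smul_eq_mul]
    ring
  · congr 1
    refine intervalIntegral.integral_congr fun θ _ => ?_
    simp only [hd, smul_eq_mul]
    ring

/-- The functions `z ^ k` are superpositions of exponentials, by Cauchy's formula for the `k`-th
derivative of `t ↦ e ^ (z t)` at the origin. -/
theorem expIntegral_zpow {R : ℝ} (hR : 0 < R) (k : ℕ) (z : ℂ) :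
    expIntegral R (fun t => k.factorial * (1 / t ^ (k + 1))) z = z ^ k := by
  have h := DifferentiableOn.circleIntegral_one_div_sub_center_pow_smul (c := 0)
    (f := fun t => Complex.exp (z * t)) hR k
    (by fun_prop)
  have h1 : iteratedDeriv k (fun t => Complex.exp (z * t)) 0 = z ^ k := by
    rw [iteratedDeriv_comp_const_mul (f := Complex.exp) Complex.contDiff_exp z]
    simp [iteratedDeriv_eq_iterate]
  have h2 : (∮ t in C(0, R), Complex.exp (z * t) * (k.factorial * (1 / t ^ (k + 1)))) =
      k.factorial * ∮ t in C(0, R), (1 / (t - 0) ^ (k + 1)) • Complex.exp (z * t) := by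
    rw [← circleIntegral.integral_const_mul]
    congr 1
    ext t
    rw [sub_zero, smul_eq_mul]
    ring
  rw [expIntegral, h2, h, h1]
  have h3 : (k.factorial : ℂ) ≠ 0 := by exact_mod_cast k.factorial_ne_zero
  have h4 : (Real.pi : ℂ) ≠ 0 := by exact_mod_cast Real.pi_ne_zero
  simp only [smul_eq_mul]
  field_simp

/-- The entire functions `z ↦ (2πi)⁻¹ ∮ e ^ (z t) g(t) dt` with `g` holomorphic off the origin; the
integral does not depend on the circle about the origin. -/
noncomputable def expIntegralSubmodule : Submodule ℂ EntireFunction where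
  carrier := {y | ∃ g : ℂ → ℂ, (∀ t, t ≠ 0 → DifferentiableAt ℂ g t) ∧
    ∀ R : ℝ, 0 < R → ∀ z, (y : C(ℂ, ℂ)) z = expIntegral R g z}
  zero_mem' := by
    refine ⟨0, fun t _ => differentiableAt_const _, fun R _ z => ?_⟩
    simp [expIntegral, circleIntegral]
  add_mem' := by
    rintro y₁ y₂ ⟨g₁, hg₁, h₁⟩ ⟨g₂, hg₂, h₂⟩
    refine ⟨g₁ + g₂, fun t ht => (hg₁ t ht).add (hg₂ t ht), fun R hR z => ?_⟩
    have hint : ∀ g : ℂ → ℂ, (∀ t, t ≠ 0 → DifferentiableAt ℂ g t) →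
        CircleIntegrable (fun t => Complex.exp (z * t) * g t) 0 R := fun g hg => by
      refine ContinuousOn.circleIntegrable hR.le fun t ht => ContinuousAt.continuousWithinAt ?_
      have : DifferentiableAt ℂ g t := hg t (ne_of_mem_sphere ht hR.ne')
      exact ((differentiableAt_id.const_mul z).cexp.mul this).continuousAt
    change (y₁ : C(ℂ, ℂ)) z + (y₂ : C(ℂ, ℂ)) z = _
    rw [h₁ R hR, h₂ R hR, expIntegral, expIntegral, expIntegral, ← smul_add,
      ← circleIntegral.integral_add (hint g₁ hg₁) (hint g₂ hg₂)]
    simp only [Pi.add_apply, mul_add]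
  smul_mem' := by
    rintro c y ⟨g, hg, h⟩
    refine ⟨fun t => c * g t, fun t ht => (hg t ht).const_mul c, fun R hR z => ?_⟩
    change c * (y : C(ℂ, ℂ)) z = _
    rw [h R hR, expIntegral, expIntegral, smul_eq_mul, smul_eq_mul, mul_left_comm,
      ← circleIntegral.integral_const_mul]
    simp only [mul_left_comm]

theorem dense_expIntegralSubmodule : Dense (expIntegralSubmodule : Set EntireFunction) := by
  refine EntireFunction.dense_of_monomial_mem _ fun k => ?_
  refine ⟨fun t => k.factorial * (1 / t ^ (k + 1)), fun t ht => ?_, fun R hR z => ?_⟩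
  · have := pow_ne_zero (k + 1) ht
    fun_prop (disch := assumption)
  · exact (expIntegral_zpow hR k z).symm

/-- A dense sequence of superpositions of exponentials with densities holomorphic off the origin. -/
theorem exists_denseRange_expIntegral :
    ∃ (y : ℕ → EntireFunction) (g : ℕ → ℂ → ℂ), DenseRange y ∧
      (∀ p t, t ≠ 0 → DifferentiableAt ℂ (g p) t) ∧
      ∀ p (R : ℝ), 0 < R → ∀ z, (y p : C(ℂ, ℂ)) z = expIntegral R (g p) z := by
  have : SecondCountableTopology EntireFunction :=
    TopologicalSpace.Subtype.secondCountableTopology _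
  obtain ⟨s, hsub, hc, hd⟩ := dense_expIntegralSubmodule.exists_countable_dense_subset
  obtain ⟨y, rfl⟩ := hc.exists_eq_range hd.nonempty
  choose g hg hy using fun p => hsub (Set.mem_range_self p)
  exact ⟨y, g, hd, hg, hy⟩

/-! ### Decay of the ratios of the symbols on the two circles -/

theorem norm_div_le_geometric_of_sum_le {φ : ℕ → ℂ} (hφ : ∀ n, 1 ≤ n → φ n ≠ 0)
    {α : ℕ → ℕ → ℝ} (hα : ∀ n j, j < n → 0 < α n j) {C : ℝ} (hC : 0 < C)
    (hsum : ∀ n, 1 ≤ n → ∑ j ∈ Finset.range n, α n j ≤ C)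
    (h : ∀ n j, j < n → ‖φ n‖ ≤ α n j * ‖φ j‖) {j n : ℕ} (hj : 1 ≤ j) (hjn : j ≤ n) :
    ‖φ n‖ / ‖φ j‖ ≤ (C + 1) * (C / (C + 1)) ^ (n - j) := by
  have hpos : ∀ n, 0 < ‖φ (n + 1)‖ := fun n => norm_pos_iff.2 (hφ _ (Nat.le_add_left 1 n))
  have key := le_geometric_of_sum_ratio_le hpos hC (fun n => ?_) (Nat.sub_le_sub_right hjn 1)
  · rwa [Nat.sub_add_cancel hj, Nat.sub_add_cancel (hj.trans hjn),
      Nat.sub_sub_sub_cancel_right hj] at key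
  · refine le_trans ?_ (hsum (n + 1) (Nat.le_add_left 1 n))
    rw [Finset.sum_range_succ']
    refine le_trans (Finset.sum_le_sum fun j hj => ?_)
      (le_add_of_nonneg_right (hα (n + 1) 0 n.succ_pos).le)
    rw [div_le_iff₀ (hpos j)]
    exact h _ _ (Nat.succ_lt_succ (Finset.mem_range.1 hj))

theorem norm_div_le_geometric_of_tsum_le {φ : ℕ → ℂ} (hφ : ∀ n, 1 ≤ n → φ n ≠ 0)
    {β : ℕ → ℕ → ℝ} {C : ℝ} (hC : 0 < C)
    (hsum : ∀ j, 1 ≤ j → Summable (fun m => β (j + 1 + m) j) ∧ ∑' m, β (j + 1 + m) j ≤ C)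
    (h : ∀ n j, 1 ≤ j → j < n → ‖φ j‖ ≤ β n j * ‖φ n‖) {j n : ℕ} (hj : 1 ≤ j) (hjn : j ≤ n) :
    ‖φ j‖ / ‖φ n‖ ≤ (C + 1) * (C / (C + 1)) ^ (n - j) := by
  have hpos : ∀ n, 0 < ‖φ (n + 1)‖ := fun n => norm_pos_iff.2 (hφ _ (Nat.le_add_left 1 n))
  have key := le_geometric_of_tsum_ratio_le hpos hC (fun j => ?_) (Nat.sub_le_sub_right hjn 1)
  · rwa [Nat.sub_add_cancel hj, Nat.sub_add_cancel (hj.trans hjn),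
      Nat.sub_sub_sub_cancel_right hj] at key
  · obtain ⟨hs, hle⟩ := hsum (j + 1) (Nat.le_add_left 1 j)
    have hterm : ∀ m, ‖φ (j + 1)‖ / ‖φ (j + 1 + m + 1)‖ ≤ β (j + 1 + 1 + m) (j + 1) := fun m => by
      rw [div_le_iff₀ (hpos _), show j + 1 + m + 1 = j + 1 + 1 + m by ring]
      exact h _ _ (Nat.le_add_left 1 j) (by omega)
    have hs' := Summable.of_nonneg_of_le (fun m => div_nonneg (norm_nonneg _) (norm_nonneg _))
      hterm hs
    exact ⟨hs', (hs'.tsum_le_tsum hterm hs).trans hle⟩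

/-! ### Frequent hypercyclicity of `(Φₙ(D))` -/

theorem exists_norm_le_of_continuousOn_sphere {g : ℂ → ℂ} {R : ℝ}
    (hg : ContinuousOn g (sphere 0 R)) : ∃ M : ℝ, 0 ≤ M ∧ ∀ t : ℂ, ‖t‖ = R → ‖g t‖ ≤ M := by
  obtain ⟨M, hM⟩ := (isCompact_sphere (0 : ℂ) R).exists_bound_of_continuousOn hg
  exact ⟨max M 0, le_max_right _ _, fun t ht =>
    (hM t (mem_sphere_zero_iff_norm.2 ht)).trans (le_max_left _ _)⟩

theorem mainTheorem1 (Φ : ℕ → ℂ → ℂ) (hΦ : ∀ n, IsExponentialType (Φ n))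
    (hΦ0 : Φ 0 = fun _ => 1)
    (R₁ R₂ R₃ : ℝ) (hR₁ : 0 < R₁) (hR₂ : 0 < R₂) (hR₃ : 0 < R₃)
    (α β : ℕ → ℕ → ℝ)
    (hα : ∀ n j : ℕ, j < n → 0 < α n j)
    (hβ : ∀ n j : ℕ, 1 ≤ j → j < n → 0 < β n j)
    (ha₁ : ∃ C : ℝ, ∀ n : ℕ, 1 ≤ n → ∑ j ∈ Finset.range n, α n j ≤ C)
    (ha₂ : ∃ C : ℝ, ∀ j : ℕ, 1 ≤ j →
      Summable (fun m : ℕ => β (j + 1 + m) j) ∧ ∑' m : ℕ, β (j + 1 + m) j ≤ C)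
    (hb : ∀ n : ℕ, 1 ≤ n → ∀ t ∈ closedAnnulus R₁ R₂ R₃, Φ n t ≠ 0)
    (hc : ∀ n j : ℕ, j < n → ∀ t : ℂ, ‖t‖ = R₁ → ‖Φ n t‖ ≤ α n j * ‖Φ j t‖)
    (hd : ∀ n j : ℕ, 1 ≤ j → j < n → ∀ t : ℂ, ‖t‖ = R₂ → ‖Φ j t‖ ≤ β n j * ‖Φ n t‖)
    (he : Summable (fun m : ℕ => 1 / minOnCircle (Φ (m + 1)) R₃)) :
    IsFrequentlyHypercyclic (fun n : ℕ => diffOp (Φ n) (hΦ n)) := by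
  have hne : ∀ n, ∀ t : ℂ, min R₁ R₂ ≤ ‖t‖ → ‖t‖ ≤ max R₁ R₂ → Φ n t ≠ 0 := by
    intro n t h1 h2
    rcases Nat.eq_zero_or_pos n with rfl | hn
    · simp [hΦ0]
    · refine hb n hn t ⟨le_trans ?_ h1, h2.trans ?_⟩
      · exact min_le_min le_rfl (min_le_left _ _)
      · exact max_le_max le_rfl (le_max_left _ _)
  have hne₁ : ∀ n, ∀ t : ℂ, ‖t‖ = R₁ → Φ n t ≠ 0 := fun n t ht =>
    hne n t (ht ▸ min_le_left _ _) (ht ▸ le_max_left _ _)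
  have hne₂ : ∀ n, ∀ t : ℂ, ‖t‖ = R₂ → Φ n t ≠ 0 := fun n t ht =>
    hne n t (ht ▸ min_le_right _ _) (ht ▸ le_max_right _ _)
  -- Uniform geometric decay on both circles.
  obtain ⟨K, ρ, hK, hρ0, hρ1, hdec₁, hdec₂⟩ : ∃ K ρ : ℝ, 0 < K ∧ 0 < ρ ∧ ρ < 1 ∧
      (∀ t : ℂ, ‖t‖ = R₁ → ∀ j n, 1 ≤ j → j ≤ n → ‖Φ n t‖ / ‖Φ j t‖ ≤ K * ρ ^ (n - j)) ∧
      (∀ t : ℂ, ‖t‖ = R₂ → ∀ j n, 1 ≤ j → j ≤ n → ‖Φ j t‖ / ‖Φ n t‖ ≤ K * ρ ^ (n - j)) := by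
    obtain ⟨C₁, hC₁⟩ := ha₁
    obtain ⟨C₂, hC₂⟩ := ha₂
    set C := max (max C₁ C₂) 1
    have hC : 0 < C := lt_of_lt_of_le one_pos (le_max_right _ _)
    have h1 : C₁ ≤ C := (le_max_left _ _).trans (le_max_left _ _)
    have h2 : C₂ ≤ C := (le_max_right _ _).trans (le_max_left _ _)
    refine ⟨C + 1, C / (C + 1), by positivity, by positivity, ?_, ?_, ?_⟩
    · rw [div_lt_one (by positivity)]
      exact lt_add_one C
    · intro t ht j n hj hjn
      exact norm_div_le_geometric_of_sum_le (φ := fun n => Φ n t) (fun n _ => hne₁ n t ht) hα hC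
        (fun n hn => (hC₁ n hn).trans h1) (fun n j hjn => hc n j hjn t ht) hj hjn
    · intro t ht j n hj hjn
      exact norm_div_le_geometric_of_tsum_le (φ := fun n => Φ n t) (fun n _ => hne₂ n t ht) hC
        (fun j hj => ⟨(hC₂ j hj).1, (hC₂ j hj).2.trans h2⟩)
        (fun n j hj hjn => hd n j hj hjn t ht) hj hjn
  obtain ⟨y, g, hy, hg, hyg⟩ := exists_denseRange_expIntegral
  have hgc : ∀ p R, 0 < R → ContinuousOn (g p) (sphere 0 R) := fun p R hR t ht =>
    (hg p t (ne_of_mem_sphere ht hR.ne')).continuousAt.continuousWithinAt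
  choose M₁ hM₁ hgM₁ using fun p => exists_norm_le_of_continuousOn_sphere (hgc p R₁ hR₁)
  choose M₂ hM₂ hgM₂ using fun p => exists_norm_le_of_continuousOn_sphere (hgc p R₂ hR₂)
  have hdivc : ∀ n p, ContinuousOn (fun t => g p t / Φ n t) (sphere 0 R₂) := fun n p =>
    (hgc p R₂ hR₂).div (hΦ n).1.continuous.continuousOn fun t ht =>
      hne₂ n t (mem_sphere_zero_iff_norm.1 ht)
  obtain ⟨c, hc0, hc1⟩ := exists_norm_le_of_continuousOn_sphere (g := fun t => 1 / Φ 1 t) (R := R₂)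
    (continuousOn_const.div (hΦ 1).1.continuous.continuousOn fun t ht =>
      hne₂ 1 t (mem_sphere_zero_iff_norm.1 ht))
  -- The right inverse of `Φₙ(D)` divides the density by `Φₙ`. The factor `c / ρ`, with `c` a bound of
  -- `1 / |Φ₁|`, turns the decay of `Φ₁ / Φₙ` into one of `1 / Φₙ`.
  refine isFrequentlyHypercyclic_of_geometric_decay _ hy
    (fun n p => expIntegralEntire hR₂.le (hdivc n p))
    (G := fun p => (M₁ p + M₂ p) * (K * (1 + c / ρ)))
    (fun p => by have := hM₁ p; have := hM₂ p; positivity)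
    (E := fun r => R₁ * Real.exp (r * R₁) + R₂ * Real.exp (r * R₂))
    (fun r => by positivity) hρ0 hρ1 ?_ ?_ ?_
  · intro n p _
    ext z
    rw [diffOp_expIntegralEntire, hyg p R₂ hR₂]
    exact expIntegral_congr hR₂.le (fun t ht => mul_div_cancel₀ _ (hne₂ n t ht)) z
  · intro n p r hn z hz
    have hbound : ∀ t : ℂ, ‖t‖ = R₂ → ‖g p t / Φ n t‖ ≤ M₂ p * (c * (K * ρ ^ (n - 1))) := by
      intro t ht
      have h1 := hdec₂ t ht 1 n le_rfl hn
      have h2 := hc1 t ht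
      have h3 : g p t / Φ n t = g p t * (1 / Φ 1 t * (Φ 1 t / Φ n t)) := by
        have := hne₂ 1 t ht
        field_simp
      rw [h3, norm_mul, norm_mul, norm_div (Φ 1 t)]
      have := hM₂ p
      gcongr
      exact hgM₂ p t ht
    refine (norm_expIntegral_le hR₂.le hbound hz).trans ?_
    have h4 : ρ ^ n = ρ ^ (n - 1) * ρ := by rw [← pow_succ, Nat.sub_add_cancel hn]
    have h5 := hM₁ p
    have h6 := hM₂ p
    calc R₂ * (Real.exp (r * R₂) * (M₂ p * (c * (K * ρ ^ (n - 1)))))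
        = (R₂ * Real.exp (r * R₂)) * (M₂ p * (K * (c / ρ))) * ρ ^ n := by
          rw [h4]
          field_simp
      _ ≤ _ := by
          gcongr
          · exact le_add_of_nonneg_left (by positivity)
          · exact le_add_of_nonneg_left h5
          · exact le_add_of_nonneg_left zero_le_one
  · intro n m p r hn hm z hz
    rw [diffOp_expIntegralEntire]
    have h5 := hM₁ p
    have h6 := hM₂ p
    have hfin : ∀ R M : ℝ, 0 ≤ R * Real.exp (r * R) →
        R * Real.exp (r * R) ≤ R₁ * Real.exp (r * R₁) + R₂ * Real.exp (r * R₂) →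
        0 ≤ M → M ≤ M₁ p + M₂ p → ∀ d : ℕ,
        R * (Real.exp (r * R) * (M * (K * ρ ^ d))) ≤
          (R₁ * Real.exp (r * R₁) + R₂ * Real.exp (r * R₂)) *
            ((M₁ p + M₂ p) * (K * (1 + c / ρ))) * ρ ^ d := by
      intro R M h1 h2 h3 h4 d
      calc R * (Real.exp (r * R) * (M * (K * ρ ^ d)))
          = (R * Real.exp (r * R)) * (M * (K * 1)) * ρ ^ d := by ring
        _ ≤ _ := by
          gcongr
          exact le_add_of_nonneg_right (by positivity)
    have hnorm : ∀ t, ‖Φ n t * (g p t / Φ m t)‖ = ‖g p t‖ * (‖Φ n t‖ / ‖Φ m t‖) := fun t => by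
      rw [norm_mul, norm_div]
      ring
    rcases le_total m n with hmn | hnm
    · -- For `m ≤ n` the circle of integration is moved to radius `R₁`.
      rw [expIntegral_eq_of_differentiableAt hR₁ hR₂ fun t h1 h2 => ?_]
      · have hd' : ((m : ℤ) - n).natAbs = n - m := by omega
        rw [hd']
        refine (norm_expIntegral_le hR₁.le (M := M₁ p * (K * ρ ^ (n - m))) (fun t ht => ?_)
          hz).trans (hfin R₁ (M₁ p) (by positivity) (le_add_of_nonneg_right (by positivity)) h5
            (le_add_of_nonneg_right h6) _)
        rw [hnorm]
        exact mul_le_mul (hgM₁ p t ht) (hdec₁ t ht m n hm hmn) (by positivity) h5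
      · have ht0 : t ≠ 0 := by
          rintro rfl
          rw [norm_zero] at h1
          exact absurd h1 (not_le.2 (lt_min hR₁ hR₂))
        exact ((hΦ n).1 t).mul ((hg p t ht0).div ((hΦ m).1 t) (hne m t h1 h2))
    · have hd' : ((m : ℤ) - n).natAbs = m - n := by omega
      rw [hd']
      refine (norm_expIntegral_le hR₂.le (M := M₂ p * (K * ρ ^ (m - n))) (fun t ht => ?_)
        hz).trans (hfin R₂ (M₂ p) (by positivity) (le_add_of_nonneg_left (by positivity)) h6
          (le_add_of_nonneg_left h5) _)
      rw [hnorm]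
      exact mul_le_mul (hgM₂ p t ht) (hdec₂ t ht n m hn hnm) (by positivity) h6
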